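/- Let $\Sigma$ be a finite alphabet with at least two elements, and let $\mathrm{Pr}$ be the uniform probability measure on the $\sigma$-algebra on $\Sigma^\omega$ generated by the cylinder sets, i.e. the probability measure that assigns $1/|\Sigma|^n$ to the set of infinite words with a given prefix of length $n$. A language $L \subseteq \Sigma^\omega$ is $\omega$-regular if it is the language of a nondeterministic Büchi automaton with finitely many states, i.e. the set of infinite words having a run that starts in an initial state and visits accepting states infinitely often. If $L \subseteq \Sigma^\omega$ is $\omega$-regular and $\mathrm{Pr}(L) > 0$, then there exists a finite word $x \in \Sigma^*$ such that the set $\{w \in \Sigma^\omega : xw \in L\}$ is measurable and $\mathrm{Pr}\{w \in \Sigma^\omega : xw \in L\} = 1$. -/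

import Mathlib

open MeasureTheory

/-- The concatenation `x w` of a finite word `x` and an infinite word `w`. -/
def prependWord {A : Type*} (x : List A) (w : ℕ → A) : ℕ → A :=
  fun n => if h : n < x.length then x[n] else w (n - x.length)

/-- The cylinder set of a finite word `x`: the infinite words that have `x` as a prefix. -/
def wordCylinder {A : Type*} (x : List A) : Set (ℕ → A) :=
  {w | ∀ (i : ℕ) (h : i < x.length), w i = x[i]}

/-- The uniform probability measure on infinite words over a finite alphabet. -/
noncomputable def uniformWordMeasure (A : Type*) [Fintype A] [Nonempty A] [MeasurableSpace A] :
    Measure (ℕ → A) :=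
  Measure.infinitePi fun _ : ℕ => (PMF.uniformOfFintype A).toMeasure

/-- The set of infinite words accepted by a nondeterministic automaton under the Büchi condition:
`w` has a run that starts in an initial state and visits accepting states infinitely often. -/
def NFA.buchiLanguage {A Q : Type*} (M : NFA A Q) : Set (ℕ → A) :=
  {w | ∃ ρ : ℕ → Q, ρ 0 ∈ M.start ∧ (∀ i, ρ (i + 1) ∈ M.step (ρ i) (w i)) ∧
    {i | ρ i ∈ M.accept}.Infinite}

/-- A set of infinite words is ω-regular if it is accepted by a nondeterministic Büchi automaton
with finitely many states. -/
def IsOmegaRegular {A : Type*} (L : Set (ℕ → A)) : Prop :=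
  ∃ (Q : Type) (_ : Finite Q) (M : NFA A Q), M.buchiLanguage = L

theorem wordCylinder_eq_pi {A : Type*} [Nonempty A] (x : List A) :
    wordCylinder x =
      Set.pi (Finset.range x.length) fun i => {x.getD i (Classical.arbitrary A)} := by
  ext w
  simp only [wordCylinder, Set.mem_ofPred_eq, Set.mem_pi, Finset.coe_range, Set.mem_Iio,
    Set.mem_singleton_iff]
  refine forall₂_congr fun i h => ?_
  rw [List.getD_eq_getElem _ _ h]

/-- The measure of the cylinder set of a word of length `n` is `1 / |A| ^ n`. -/
theorem uniformWordMeasure_wordCylinder {A : Type*} [Fintype A] [Nonempty A] [MeasurableSpace A]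
    [MeasurableSingletonClass A] (x : List A) :
    uniformWordMeasure A (wordCylinder x) = 1 / (Fintype.card A : ENNReal) ^ x.length := by
  rw [wordCylinder_eq_pi, uniformWordMeasure, Measure.infinitePi_pi _ (by simp)]
  simp only [PMF.toMeasure_apply_singleton _ _ (measurableSet_singleton _),
    PMF.uniformOfFintype_apply, Finset.prod_const, Finset.card_range, one_div, ENNReal.inv_pow]

/-- The σ-algebra on infinite words is the one generated by the cylinder sets. -/
theorem measurableSpace_eq_generateFrom_wordCylinder (A : Type*) [Finite A] [Nonempty A]
    [MeasurableSpace A] [MeasurableSingletonClass A] :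
    (inferInstance : MeasurableSpace (ℕ → A)) =
      MeasurableSpace.generateFrom (Set.range (wordCylinder (A := A))) := by
  apply le_antisymm
  · refine iSup_le fun i => ?_
    rw [← measurable_iff_comap_le]
    refine @measurable_to_countable' A (ℕ → A) _ _
      (MeasurableSpace.generateFrom (Set.range (wordCylinder (A := A)))) _ fun a => ?_
    have h : (fun w : ℕ → A => w i) ⁻¹' {a} =
        ⋃ x ∈ {x : List A | x.length = i + 1 ∧ x[i]? = some a}, wordCylinder x := by
      ext w
      simp only [Set.mem_preimage, Set.mem_singleton_iff, Set.mem_iUnion, Set.mem_ofPred_eq]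
      constructor
      · rintro rfl
        exact ⟨(List.range (i + 1)).map w, by simp, by simp [wordCylinder]⟩
      · rintro ⟨x, ⟨hx, hi⟩, hw⟩
        have hlt : i < x.length := by omega
        rw [List.getElem?_eq_getElem hlt] at hi
        rw [hw i hlt]
        exact Option.some.inj hi
    rw [h]
    exact MeasurableSet.biUnion (Set.to_countable _) fun x _ =>
      MeasurableSpace.measurableSet_generateFrom ⟨x, rfl⟩
  · refine MeasurableSpace.generateFrom_le ?_
    rintro _ ⟨x, rfl⟩
    rw [wordCylinder_eq_pi]
    exact MeasurableSet.pi (Set.to_countable _) fun _ _ => measurableSet_singleton _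

/-! The left quotient of `L` by `x` is accepted by the same automaton started from the states
reached on `x`, so the quotients have only finitely many measures. Moreover Pr(L ∩ xΣ^ω) = Pr(xΣ^ω)
· Pr(x⁻¹L). If no quotient had measure 1, their largest measure c < 1 would bound the relative
measure of `L` in every cylinder. Approximating `L` by sets determined by finite prefixes then gives
Pr(L) ≤ c · Pr(L), so `L` is null (`measure_eq_zero_of_wordCylinder`).

Measurability of `L` is Büchi's Ramsey argument. Segments of a word are coloured by their profiles,
which are finite in number and compose under concatenation. Every word factors with profiles s, e,
e, …, and the pair (s, e) decides acceptance. The words of a given type form a measurable set, and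
`L` is a finite union of such sets. -/

/-- A property of infinite words over a finite alphabet that depends only on a finite prefix is
measurable. -/
theorem measurableSet_setOf_of_dependsOn {A : Type*} [Finite A] [MeasurableSpace A]
    [MeasurableSingletonClass A] {P : (ℕ → A) → Prop} {n : ℕ} (hP : DependsOn P (Set.Iio n)) :
    MeasurableSet {w | P w} := by
  let r : (ℕ → A) → (Fin n → A) := fun w i => w i
  have hr : Measurable r := measurable_pi_lambda _ fun i => measurable_pi_apply _
  have h : {w | P w} = r ⁻¹' (r '' {w | P w}) := by
    refine (Set.subset_preimage_image r _).antisymm ?_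
    rintro w ⟨v, hv, hvw⟩
    exact (hP fun i hi => congrFun hvw ⟨i, hi⟩).mp hv
  rw [h]
  exact hr (Set.toFinite _).measurableSet

/-! ### Runs on segments and their profiles -/

namespace NFA

variable {A Q : Type*} (M : NFA A Q)

/-- `ρ` follows the transitions of `M` while reading the letters of `w` at positions
`i, …, j - 1`. -/
def IsRunOn (w : ℕ → A) (i j : ℕ) (ρ : ℕ → Q) : Prop :=
  ∀ k, i ≤ k → k < j → ρ (k + 1) ∈ M.step (ρ k) (w k)

/-- The pairs of states joined by a run on the segment `[i, j)` of `w`, and those joined by a run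
that enters an accepting state on that segment. -/
def profile (w : ℕ → A) (i j : ℕ) : (Q → Q → Prop) × (Q → Q → Prop) :=
  (fun p q => ∃ ρ, M.IsRunOn w i j ρ ∧ ρ i = p ∧ ρ j = q,
    fun p q => ∃ ρ, M.IsRunOn w i j ρ ∧ ρ i = p ∧ ρ j = q ∧ ∃ k, i < k ∧ k ≤ j ∧ ρ k ∈ M.accept)

/-- The profile of a concatenation in terms of the profiles of its factors. -/
def profileComp (a b : (Q → Q → Prop) × (Q → Q → Prop)) : (Q → Q → Prop) × (Q → Q → Prop) :=
  (fun p q => ∃ r, a.1 p r ∧ b.1 r q,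
    fun p q => ∃ r, a.2 p r ∧ b.1 r q ∨ a.1 p r ∧ b.2 r q)

variable {M}

theorem IsRunOn.mono {w : ℕ → A} {i j i' j' : ℕ} {ρ : ℕ → Q} (h : M.IsRunOn w i j ρ)
    (hi : i ≤ i') (hj : j' ≤ j) : M.IsRunOn w i' j' ρ :=
  fun k hk hk' => h k (hi.trans hk) (hk'.trans_le hj)

theorem IsRunOn.glue {w : ℕ → A} {i j k : ℕ} {ρ σ : ℕ → Q} (hρ : M.IsRunOn w i j ρ)
    (hσ : M.IsRunOn w j k σ) (h : ρ j = σ j) :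
    M.IsRunOn w i k fun l => if l ≤ j then ρ l else σ l := by
  intro l hil hlk
  rcases lt_trichotomy l j with hl | rfl | hl
  · simpa [hl.le, Nat.succ_le_of_lt hl] using hρ l hil hl
  · simpa [h] using hσ l le_rfl hlk
  · have h1 : ¬ l ≤ j := by omega
    have h2 : ¬ l + 1 ≤ j := by omega
    simpa [h1, h2] using hσ l hl.le hlk

variable (M)

theorem profile_comp (w : ℕ → A) {i j k : ℕ} (hij : i ≤ j) (hjk : j ≤ k) :
    M.profile w i k = profileComp (M.profile w i j) (M.profile w j k) := by
  have glue_right : ∀ {ρ σ : ℕ → Q}, ρ j = σ j → ∀ l, j ≤ l →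
      (if l ≤ j then ρ l else σ l) = σ l := by
    intro ρ σ h l hl
    rcases hl.eq_or_lt with rfl | hl
    · simpa using h
    · simp [hl.not_ge]
  refine Prod.ext ?_ ?_
  · funext p q
    refine propext ⟨?_, ?_⟩
    · rintro ⟨ρ, hρ, hp, hq⟩
      exact ⟨ρ j, ⟨ρ, hρ.mono le_rfl hjk, hp, rfl⟩, ⟨ρ, hρ.mono hij le_rfl, rfl, hq⟩⟩
    · rintro ⟨r, ⟨ρ, hρ, hp, hr⟩, ⟨σ, hσ, hr', hq⟩⟩
      exact ⟨_, hρ.glue hσ (hr.trans hr'.symm), by simpa [hij] using hp,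
        (glue_right (hr.trans hr'.symm) k hjk).trans hq⟩
  · funext p q
    refine propext ⟨?_, ?_⟩
    · rintro ⟨ρ, hρ, hp, hq, l, hl, hl', hacc⟩
      refine ⟨ρ j, ?_⟩
      -- Visits are recorded on half-open segments (i, j], so one at the cut `j` belongs to the left
      -- factor.
      rcases le_or_gt l j with h | h
      · exact Or.inl ⟨⟨ρ, hρ.mono le_rfl hjk, hp, rfl, l, hl, h, hacc⟩,
          ⟨ρ, hρ.mono hij le_rfl, rfl, hq⟩⟩
      · exact Or.inr ⟨⟨ρ, hρ.mono le_rfl hjk, hp, rfl⟩,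
          ⟨ρ, hρ.mono hij le_rfl, rfl, hq, l, h, hl', hacc⟩⟩
    · rintro ⟨r, ⟨⟨ρ, hρ, hp, hr, l, hl, hl', hacc⟩, ⟨σ, hσ, hr', hq⟩⟩ |
        ⟨⟨ρ, hρ, hp, hr⟩, ⟨σ, hσ, hr', hq, l, hl, hl', hacc⟩⟩⟩
      · exact ⟨_, hρ.glue hσ (hr.trans hr'.symm), by simpa [hij] using hp,
          (glue_right (hr.trans hr'.symm) k hjk).trans hq, l, hl, hl'.trans hjk,
          by simpa [hl'] using hacc⟩
      · exact ⟨_, hρ.glue hσ (hr.trans hr'.symm), by simpa [hij] using hp,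
          (glue_right (hr.trans hr'.symm) k hjk).trans hq, l, hij.trans_lt hl, hl',
          by simpa [hl.not_ge] using hacc⟩

theorem dependsOn_profile {i j n : ℕ} (h : j ≤ n) :
    DependsOn (fun w : ℕ → A => M.profile w i j) (Set.Iio n) := by
  intro w v hwv
  have hrun : M.IsRunOn w i j = M.IsRunOn v i j := by
    funext ρ
    refine propext (forall_congr' fun k => forall₂_congr fun _ hk => ?_)
    rw [hwv k (hk.trans_le h)]
  simp only [profile, hrun]

/-! ### Acceptance from the profiles of a factorization -/

variable {M}

/-- A run on an infinite word can be pasted together from runs on consecutive segments. -/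
theorem mem_buchiLanguage_of_segments {w : ℕ → A} {N : ℕ → ℕ} (hN : StrictMono N) (hN0 : N 0 = 0)
    {q : ℕ → Q} (hq0 : q 0 ∈ M.start)
    (hrun : ∀ i, (M.profile w (N i) (N (i + 1))).1 (q i) (q (i + 1)))
    (hacc : {i | (M.profile w (N i) (N (i + 1))).2 (q i) (q (i + 1))}.Infinite) :
    w ∈ M.buchiLanguage := by
  have hex : ∀ i, ∃ ρ, M.IsRunOn w (N i) (N (i + 1)) ρ ∧ ρ (N i) = q i ∧
      ρ (N (i + 1)) = q (i + 1) ∧ ((M.profile w (N i) (N (i + 1))).2 (q i) (q (i + 1)) →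
        ∃ k, N i < k ∧ k ≤ N (i + 1) ∧ ρ k ∈ M.accept) := by
    intro i
    by_cases h : (M.profile w (N i) (N (i + 1))).2 (q i) (q (i + 1))
    · obtain ⟨ρ, h1, h2, h3, h4⟩ := id h
      exact ⟨ρ, h1, h2, h3, fun _ => h4⟩
    · obtain ⟨ρ, h1, h2, h3⟩ := hrun i
      exact ⟨ρ, h1, h2, h3, fun h' => absurd h' h⟩
  choose σ hσ hleft hright hσacc using hex
  -- The index of the segment containing `k`; searching up to `k` suffices because `i ≤ N i`.
  let ι : ℕ → ℕ := fun k => Nat.findGreatest (fun i => N i ≤ k) k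
  have hι : ∀ i k, N i ≤ k → k < N (i + 1) → ι k = i := by
    intro i k h1 h2
    refine le_antisymm ?_ (Nat.le_findGreatest (hN.id_le i |>.trans h1) h1)
    have h3 : N (ι k) ≤ k :=
      Nat.findGreatest_spec (P := fun i => N i ≤ k) (Nat.zero_le k) (by simp [hN0])
    exact Nat.lt_succ_iff.mp (hN.lt_iff_lt.mp (h3.trans_lt h2))
  have hcover : ∀ k, N (ι k) ≤ k ∧ k < N (ι k + 1) := by
    intro k
    refine ⟨Nat.findGreatest_spec (P := fun i => N i ≤ k) (Nat.zero_le k) (by simp [hN0]), ?_⟩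
    by_contra! h
    have := Nat.le_findGreatest (P := fun i => N i ≤ k) (hN.id_le _ |>.trans h) h
    change ι k + 1 ≤ ι k at this
    omega
  -- At the right endpoint the pasted run already follows the next piece, which agrees there with
  -- the current one.
  have hglue : ∀ i k, N i ≤ k → k ≤ N (i + 1) → σ (ι k) k = σ i k := by
    intro i k h1 h2
    rcases h2.eq_or_lt with rfl | h2
    · rw [hι (i + 1) _ le_rfl (hN (Nat.lt_succ_self _)), hleft, hright]
    · rw [hι i k h1 h2]
  refine ⟨fun k => σ (ι k) k, ?_, fun k => ?_, ?_⟩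
  · have h := hglue 0 0 hN0.le (Nat.zero_le _)
    have h' := hleft 0
    rw [hN0] at h'
    simpa only [h, h'] using hq0
  · obtain ⟨h1, h2⟩ := hcover k
    have h := hσ (ι k) k h1 h2
    rwa [← hglue (ι k) (k + 1) (h1.trans k.le_succ) h2] at h
  · refine Set.infinite_of_not_bddAbove fun ⟨b, hb⟩ => ?_
    obtain ⟨i, hi, hbi⟩ := hacc.exists_gt b
    obtain ⟨k, hk, hk', hka⟩ := hσacc i hi
    rw [← hglue i k hk.le hk'] at hka
    have : k ≤ b := hb hka
    have : i ≤ N i := hN.id_le i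
    omega

/-- Membership in the language only depends on the profiles of the factors of a factorization. -/
theorem mem_buchiLanguage_of_profile_eq {w v : ℕ → A} {N N' : ℕ → ℕ} (hN : StrictMono N)
    (hN0 : N 0 = 0) (hN' : StrictMono N') (hN'0 : N' 0 = 0)
    (h : ∀ i, M.profile w (N i) (N (i + 1)) = M.profile v (N' i) (N' (i + 1)))
    (hw : w ∈ M.buchiLanguage) : v ∈ M.buchiLanguage := by
  obtain ⟨ρ, hρ0, hρ, hacc⟩ := hw
  refine mem_buchiLanguage_of_segments hN' hN'0 (q := fun i => ρ (N i)) (by simpa [hN0]) ?_ ?_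
  · intro i
    rw [← h]
    exact ⟨ρ, fun k _ _ => hρ k, rfl, rfl⟩
  · refine Set.infinite_of_not_bddAbove fun ⟨b, hb⟩ => ?_
    -- A visit beyond `N (b + 1)` falls in a segment (N i, N (i + 1)] with `i > b`.
    obtain ⟨k, hk, hbk⟩ := hacc.exists_gt (N (b + 1))
    have hex : ∃ i, k ≤ N i := ⟨k, hN.id_le k⟩
    obtain ⟨i, hi⟩ : ∃ i, Nat.find hex = i + 1 := by
      refine Nat.exists_eq_succ_of_ne_zero fun h0 => ?_
      have := Nat.find_spec hex
      rw [h0, hN0] at this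
      omega
    have h1 : k ≤ N (i + 1) := hi ▸ Nat.find_spec hex
    have h2 : N i < k := not_le.mp (Nat.find_min hex (by omega))
    have h3 : b < i := by
      have := hN.lt_iff_lt.mp (hbk.trans_le h1)
      omega
    refine h3.not_ge (hb ?_)
    change (M.profile v (N' i) (N' (i + 1))).2 (ρ (N i)) (ρ (N (i + 1)))
    rw [← h]
    exact ⟨ρ, fun k _ _ => hρ k, rfl, rfl, k, h2, h1, hk⟩

/-! ### Ramsey factorizations and measurability -/

variable (M)

/-- The words with a prefix of profile `s` that ends at a position `n` such that infinitely many
later positions `m` merge with `n` and have `e` as the profile of the segment from `n` to `m`. -/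
def profileType (s e : (Q → Q → Prop) × (Q → Q → Prop)) : Set (ℕ → A) :=
  {w | ∃ n, 0 < n ∧ M.profile w 0 n = s ∧ ∀ b, ∃ m, b < m ∧ n < m ∧ M.profile w n m = e ∧
    ∃ k, m ≤ k ∧ M.profile w n k = M.profile w m k}

/-- Asking for a whole sequence of cut points would be an uncountable quantifier. The merging
condition replaces it by quantifiers over ℕ applied to conditions on finite prefixes. -/
theorem measurableSet_profileType [Finite A] [MeasurableSpace A] [MeasurableSingletonClass A]
    (s e : (Q → Q → Prop) × (Q → Q → Prop)) : MeasurableSet (M.profileType s e) := by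
  have h1 : ∀ i j t, Measurable fun w : ℕ → A => M.profile w i j = t := fun i j t =>
    measurableSet_setOfPred.mp <| measurableSet_setOf_of_dependsOn (n := j) fun w v h => by
      have := M.dependsOn_profile (i := i) le_rfl h
      simp only at this
      simp only [this]
  have h2 : ∀ i j k, Measurable fun w : ℕ → A => M.profile w i k = M.profile w j k := fun i j k =>
    measurableSet_setOfPred.mp <| measurableSet_setOf_of_dependsOn (n := k) fun w v h => by
      have hi := M.dependsOn_profile (i := i) le_rfl h
      have hj := M.dependsOn_profile (i := j) le_rfl h
      simp only at hi hj
      simp only [hi, hj]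
  refine measurableSet_setOfPred.mpr ?_
  refine Measurable.exists fun n => measurable_const.and ((h1 _ _ _).and ?_)
  refine Measurable.forall fun b => Measurable.exists fun m => measurable_const.and
    (measurable_const.and ((h1 _ _ _).and ?_))
  exact Measurable.exists fun k => measurable_const.and (h2 _ _ _)

/-- Ramsey's theorem by a nonprincipal ultrafilter: `c m` is the profile from `m` to almost every
`k`, and `e` is the value of `c` at almost every `m`. Positions `n`, `m` with `c n = c m = e` merge
at almost every `k`. -/
theorem exists_mem_profileType [Finite Q] (w : ℕ → A) : ∃ s e, w ∈ M.profileType s e := by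
  let U := Filter.hyperfilter ℕ
  have hU : ∀ b, ∀ᶠ k in (U : Filter ℕ), b < k := fun b =>
    Nat.hyperfilter_le_atTop (Filter.eventually_gt_atTop b)
  have hcol : ∀ f : ℕ → (Q → Q → Prop) × (Q → Q → Prop), ∃ c, ∀ᶠ k in (U : Filter ℕ), f k = c := by
    intro f
    obtain ⟨c, -, hc⟩ := (U.eventually_exists_mem_iff (P := fun c k => f k = c)
      (Set.toFinite Set.univ)).mp (Filter.Eventually.of_forall fun k => ⟨f k, trivial, rfl⟩)
    exact ⟨c, hc⟩
  choose c hc using fun m => hcol (M.profile w m)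
  obtain ⟨e, he⟩ := hcol c
  obtain ⟨n, hne, hn⟩ := (he.and (hU 0)).exists
  refine ⟨_, e, n, hn, rfl, fun b => ?_⟩
  obtain ⟨m, hme, hm, hbm, hnm⟩ := (he.and ((hc n).and ((hU b).and (hU n)))).exists
  obtain ⟨k, hk, hk', hmk⟩ := ((hc n).and ((hc m).and (hU m))).exists
  exact ⟨m, hbm, hnm, hm.trans hne, k, hmk.le, by rw [hk, hk', hne, hme]⟩

variable {M}

theorem exists_factorization_of_mem_profileType {w : ℕ → A}
    {s e : (Q → Q → Prop) × (Q → Q → Prop)} (hw : w ∈ M.profileType s e) :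
    ∃ N : ℕ → ℕ, StrictMono N ∧ N 0 = 0 ∧ M.profile w (N 0) (N 1) = s ∧
      ∀ i, M.profile w (N (i + 1)) (N (i + 2)) = e := by
  obtain ⟨n, hn, hs, hinf⟩ := hw
  let G : Set ℕ := {m | n ≤ m ∧ ∃ k, m ≤ k ∧ M.profile w n k = M.profile w m k}
  have hnext : ∀ m : G, ∃ m' : G, m.1 < m'.1 ∧ M.profile w m m' = e := by
    rintro ⟨m, hnm, k, hmk, hk⟩
    -- Beyond the merging point `k`, segments starting at `m` and at `n` have equal profiles, so the
    -- one from `m` to `m'` inherits `e`.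
    obtain ⟨m', hkm', hnm', he, hmerge⟩ := hinf k
    refine ⟨⟨m', hnm'.le, hmerge⟩, hmk.trans_lt hkm', ?_⟩
    rw [← he, M.profile_comp w hmk hkm'.le, M.profile_comp w (hnm.trans hmk) hkm'.le, hk]
  choose f hf hfe using hnext
  let g : ℕ → G := fun i => f^[i] ⟨n, le_rfl, n, le_rfl, rfl⟩
  have hg : ∀ i, g (i + 1) = f (g i) := fun i => Function.iterate_succ_apply' f i _
  refine ⟨fun i => Nat.casesOn i 0 fun j => (g j).1, strictMono_nat_of_lt_succ ?_, rfl, hs, ?_⟩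
  · rintro (_ | i)
    · exact hn
    · change (g i).1 < (g (i + 1)).1
      rw [hg]
      exact hf _
  · intro i
    change M.profile w (g i).1 (g (i + 1)).1 = e
    rw [hg]
    exact hfe _

theorem mem_buchiLanguage_of_mem_profileType {w v : ℕ → A}
    {s e : (Q → Q → Prop) × (Q → Q → Prop)} (hw : w ∈ M.profileType s e)
    (hv : v ∈ M.profileType s e) (h : w ∈ M.buchiLanguage) : v ∈ M.buchiLanguage := by
  obtain ⟨N, hN, hN0, hs, he⟩ := exists_factorization_of_mem_profileType hw
  obtain ⟨N', hN', hN'0, hs', he'⟩ := exists_factorization_of_mem_profileType hv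
  refine mem_buchiLanguage_of_profile_eq hN hN0 hN' hN'0 ?_ h
  rintro (_ | i)
  · exact hs.trans hs'.symm
  · exact (he i).trans (he' i).symm

variable (M)

/-- Types cover all words, and a type meeting the language lies inside it. -/
theorem measurableSet_buchiLanguage [Finite A] [MeasurableSpace A] [MeasurableSingletonClass A]
    [Finite Q] : MeasurableSet M.buchiLanguage := by
  have h : M.buchiLanguage =
      ⋃ (s) (e) (_ : (M.profileType s e ∩ M.buchiLanguage).Nonempty), M.profileType s e := by
    ext v
    simp only [Set.mem_iUnion]
    constructor
    · intro hv
      obtain ⟨s, e, hse⟩ := M.exists_mem_profileType v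
      exact ⟨s, e, ⟨v, hse, hv⟩, hse⟩
    · rintro ⟨s, e, ⟨w, hw, hwL⟩, hv⟩
      exact mem_buchiLanguage_of_mem_profileType hw hv hwL
  rw [h]
  exact MeasurableSet.iUnion fun s => MeasurableSet.iUnion fun e => MeasurableSet.iUnion fun _ =>
    M.measurableSet_profileType s e

/-! ### Left quotients -/

/-- The automaton `M` with its set of initial states replaced by `S`. -/
def withStart (S : Set Q) : NFA A Q := { M with start := S }

theorem cons_mem_buchiLanguage_withStart (S : Set Q) (a : A) (w : ℕ → A) :
    (fun n => Nat.casesOn n a w : ℕ → A) ∈ (M.withStart S).buchiLanguage ↔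
      w ∈ (M.withStart (M.stepSet S a)).buchiLanguage := by
  constructor
  · rintro ⟨ρ, h0, hρ, hacc⟩
    refine ⟨fun n => ρ (n + 1), M.mem_stepSet.mpr ⟨ρ 0, h0, hρ 0⟩, fun i => hρ (i + 1), ?_⟩
    refine Set.infinite_of_not_bddAbove fun ⟨b, hb⟩ => ?_
    obtain ⟨k, hk, hbk⟩ := hacc.exists_gt (b + 1)
    obtain ⟨k, rfl⟩ : ∃ l, k = l + 1 := ⟨k - 1, by omega⟩
    have : k ≤ b := hb hk
    omega
  · rintro ⟨ρ, h0, hρ, hacc⟩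
    obtain ⟨p, hp, hstep⟩ := M.mem_stepSet.mp h0
    let σ : ℕ → Q := fun n => Nat.casesOn n p ρ
    refine ⟨σ, hp, ?_, ?_⟩
    · rintro (_ | i)
      · exact hstep
      · exact hρ i
    · refine Set.infinite_of_not_bddAbove fun ⟨b, hb⟩ => ?_
      obtain ⟨k, hk, hbk⟩ := hacc.exists_gt b
      have : k + 1 ≤ b := hb hk
      omega

end NFA

theorem prependWord_nil {A : Type*} (w : ℕ → A) : prependWord [] w = w := by
  funext n
  simp [prependWord]

theorem prependWord_cons {A : Type*} (a : A) (x : List A) (w : ℕ → A) :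
    prependWord (a :: x) w = fun n => Nat.casesOn n a (prependWord x w) := by
  funext n
  cases n <;> simp [prependWord]

/-- Reading `x` turns the language of an automaton into its left quotient by `x`. -/
theorem NFA.prependWord_mem_buchiLanguage {A Q : Type*} (M : NFA A Q) (S : Set Q) (x : List A)
    (w : ℕ → A) : prependWord x w ∈ (M.withStart S).buchiLanguage ↔
      w ∈ (M.withStart (M.evalFrom S x)).buchiLanguage := by
  induction x generalizing S with
  | nil => rw [prependWord_nil, NFA.evalFrom_nil]
  | cons a x ih =>
    rw [prependWord_cons, NFA.cons_mem_buchiLanguage_withStart, ih, NFA.evalFrom_cons]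

/-! ### Self-similarity of the uniform measure -/

instance (A : Type*) [Fintype A] [Nonempty A] [MeasurableSpace A] :
    IsProbabilityMeasure (uniformWordMeasure A) := by
  unfold uniformWordMeasure
  infer_instance

theorem measurableSet_wordCylinder {A : Type*} [Finite A] [MeasurableSpace A]
    [MeasurableSingletonClass A] (x : List A) : MeasurableSet (wordCylinder x) :=
  measurableSet_setOf_of_dependsOn (n := x.length) fun w v h =>
    propext (forall₂_congr fun i hi => by rw [h i hi])

theorem measurable_prependWord {A : Type*} [MeasurableSpace A] (x : List A) :
    Measurable (prependWord x) := by
  refine measurable_pi_lambda _ fun n => ?_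
  by_cases h : n < x.length
  · simp only [prependWord, h, dif_pos]
    exact measurable_const
  · simp only [prependWord, h, dif_neg, not_false_iff]
    exact measurable_pi_apply _

theorem prependWord_mem_wordCylinder_of_le {A : Type*} {x y : List A} (h : x.length ≤ y.length)
    (w : ℕ → A) : prependWord x w ∈ wordCylinder y ↔
      x <+: y ∧ w ∈ wordCylinder (y.drop x.length) := by
  constructor
  · intro hw
    have hxy : x <+: y := by
      rw [List.prefix_iff_getElem]
      refine ⟨h, fun i hi => ?_⟩
      have := hw i (hi.trans_le h)
      simpa [prependWord, hi] using this
    refine ⟨hxy, fun i hi => ?_⟩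
    rw [List.length_drop] at hi
    have := hw (x.length + i) (by omega)
    simpa [prependWord] using this
  · rintro ⟨hxy, hw⟩ i hi
    rcases lt_or_ge i x.length with h' | h'
    · simpa [prependWord, h'] using hxy.getElem h'
    · have := hw (i - x.length) (by rw [List.length_drop]; omega)
      simp only [List.getElem_drop] at this
      simp only [prependWord, h'.not_gt, dif_neg, not_false_iff, this]
      congr 1
      omega

theorem wordCylinder_subset_of_prefix {A : Type*} {x y : List A} (h : x <+: y) :
    wordCylinder y ⊆ wordCylinder x := by
  intro w hw i hi
  rw [hw i (hi.trans_le h.length_le), h.getElem hi]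

theorem prefix_of_mem_wordCylinder {A : Type*} {x y : List A} {w : ℕ → A}
    (hx : w ∈ wordCylinder x) (hy : w ∈ wordCylinder y) (h : x.length ≤ y.length) : x <+: y := by
  rw [List.prefix_iff_getElem]
  exact ⟨h, fun i hi => (hx i hi).symm.trans (hy i (hi.trans_le h))⟩

theorem isPiSystem_range_wordCylinder (A : Type*) :
    IsPiSystem (Set.range (wordCylinder (A := A))) := by
  rintro _ ⟨x, rfl⟩ _ ⟨y, rfl⟩ ⟨w, hx, hy⟩
  rcases le_total x.length y.length with h | h
  · exact ⟨y, (Set.inter_eq_right.mpr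
      (wordCylinder_subset_of_prefix (prefix_of_mem_wordCylinder hx hy h))).symm⟩
  · exact ⟨x, (Set.inter_eq_left.mpr
      (wordCylinder_subset_of_prefix (prefix_of_mem_wordCylinder hy hx h))).symm⟩

theorem prependWord_mem_wordCylinder {A : Type*} (x : List A) (w : ℕ → A) :
    prependWord x w ∈ wordCylinder x := fun i hi => by simp [prependWord, hi]

/-- The uniform measure restricted to a cylinder is a scaled copy of the uniform measure. -/
theorem uniformWordMeasure_restrict_wordCylinder {A : Type*} [Fintype A] [Nonempty A]
    [MeasurableSpace A] [MeasurableSingletonClass A] (x : List A) :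
    (uniformWordMeasure A).restrict (wordCylinder x) =
      uniformWordMeasure A (wordCylinder x) • (uniformWordMeasure A).map (prependWord x) := by
  have hx : MeasurableSet (wordCylinder x) := measurableSet_wordCylinder x
  have hmap := measurable_prependWord (A := A) x
  refine ext_of_generate_finite _ (measurableSpace_eq_generateFrom_wordCylinder A)
    (isPiSystem_range_wordCylinder A) ?_ ?_
  · rintro _ ⟨y, rfl⟩
    have hy := measurableSet_wordCylinder y
    rw [Measure.restrict_apply hy, Measure.smul_apply, Measure.map_apply hmap hy, smul_eq_mul]
    -- Two cylinders are nested, in one of two ways, or disjoint.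
    by_cases hxy : x <+: y
    · obtain ⟨z, rfl⟩ := hxy
      have h : prependWord x ⁻¹' wordCylinder (x ++ z) = wordCylinder z := by
        ext w
        rw [Set.mem_preimage, prependWord_mem_wordCylinder_of_le (by simp)]
        simp
      rw [Set.inter_eq_left.mpr (wordCylinder_subset_of_prefix (List.prefix_append x z)), h]
      simp only [uniformWordMeasure_wordCylinder, one_div, List.length_append, pow_add]
      exact ENNReal.mul_inv (Or.inr (by simp)) (Or.inr (by simp))
    by_cases hyx : y <+: x
    · have h : prependWord x ⁻¹' wordCylinder y = Set.univ :=
        Set.eq_univ_of_forall fun w =>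
          wordCylinder_subset_of_prefix hyx (prependWord_mem_wordCylinder x w)
      rw [Set.inter_eq_right.mpr (wordCylinder_subset_of_prefix hyx), h, measure_univ, mul_one]
    · have hdisj : ∀ w, w ∈ wordCylinder x → w ∉ wordCylinder y := fun w hw hw' =>
        (le_total x.length y.length).elim (fun h => hxy (prefix_of_mem_wordCylinder hw hw' h))
          fun h => hyx (prefix_of_mem_wordCylinder hw' hw h)
      have h : prependWord x ⁻¹' wordCylinder y = ∅ :=
        Set.eq_empty_of_forall_notMem fun w => hdisj _ (prependWord_mem_wordCylinder x w)
      have h' : wordCylinder y ∩ wordCylinder x = ∅ :=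
        Set.eq_empty_of_forall_notMem fun w hw => hdisj w hw.2 hw.1
      rw [h, h', measure_empty, mul_zero]
  · rw [Measure.restrict_apply_univ, Measure.smul_apply, Measure.map_apply hmap MeasurableSet.univ,
      Set.preimage_univ, measure_univ, smul_eq_mul, mul_one]

theorem uniformWordMeasure_inter_wordCylinder {A : Type*} [Fintype A] [Nonempty A]
    [MeasurableSpace A] [MeasurableSingletonClass A] {L : Set (ℕ → A)} (hL : MeasurableSet L)
    (x : List A) : uniformWordMeasure A (L ∩ wordCylinder x) =
      uniformWordMeasure A (wordCylinder x) * uniformWordMeasure A {w | prependWord x w ∈ L} := by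
  rw [← Measure.restrict_apply hL, uniformWordMeasure_restrict_wordCylinder, Measure.smul_apply,
    Measure.map_apply (measurable_prependWord x) hL, smul_eq_mul]
  rfl

/-! ### Approximation by sets determined by finite prefixes -/

/-- The sets of infinite words determined by a finite prefix. -/
def prefixSets (A : Type*) : Set (Set (ℕ → A)) :=
  {S | ∃ n, DependsOn (· ∈ S) (Set.Iio n)}

/-- Approximation in measure needs a generating ring, while cylinders are not closed under unions
and differences. -/
theorem isSetRing_prefixSets (A : Type*) : IsSetRing (prefixSets A) where
  empty_mem := ⟨0, fun _ _ _ => rfl⟩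
  union_mem := by
    rintro S T ⟨m, hm⟩ ⟨n, hn⟩
    refine ⟨max m n, fun w v h => ?_⟩
    have h1 := hm fun i hi => h i (Set.Iio_subset_Iio (le_max_left m n) hi)
    have h2 := hn fun i hi => h i (Set.Iio_subset_Iio (le_max_right m n) hi)
    simp only at h1 h2
    simp only [Set.mem_union, h1, h2]
  sdiff_mem := by
    rintro S T ⟨m, hm⟩ ⟨n, hn⟩
    refine ⟨max m n, fun w v h => ?_⟩
    have h1 := hm fun i hi => h i (Set.Iio_subset_Iio (le_max_left m n) hi)
    have h2 := hn fun i hi => h i (Set.Iio_subset_Iio (le_max_right m n) hi)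
    simp only at h1 h2
    simp only [Set.mem_sdiff, h1, h2]

theorem wordCylinder_mem_prefixSets {A : Type*} (x : List A) : wordCylinder x ∈ prefixSets A :=
  ⟨x.length, fun w v h => propext (forall₂_congr fun i hi => by rw [h i hi])⟩

theorem measurableSpace_eq_generateFrom_prefixSets (A : Type*) [Finite A] [Nonempty A]
    [MeasurableSpace A] [MeasurableSingletonClass A] :
    (inferInstance : MeasurableSpace (ℕ → A)) = MeasurableSpace.generateFrom (prefixSets A) := by
  apply le_antisymm
  · rw [measurableSpace_eq_generateFrom_wordCylinder A]
    refine MeasurableSpace.generateFrom_mono ?_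
    rintro _ ⟨x, rfl⟩
    exact wordCylinder_mem_prefixSets x
  · refine MeasurableSpace.generateFrom_le ?_
    rintro S ⟨n, hn⟩
    exact measurableSet_setOf_of_dependsOn hn

/-- A bound for the relative measure of `L` in all cylinders extends to all sets determined by a
finite prefix. -/
theorem measure_inter_le_of_wordCylinder {A : Type*} [Finite A] [MeasurableSpace A]
    [MeasurableSingletonClass A] (μ : Measure (ℕ → A)) {L : Set (ℕ → A)} {c : ENNReal}
    (h : ∀ x : List A, μ (L ∩ wordCylinder x) ≤ c * μ (wordCylinder x)) {S : Set (ℕ → A)}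
    (hS : S ∈ prefixSets A) : μ (L ∩ S) ≤ c * μ S := by
  obtain ⟨n, hn⟩ := hS
  have hmem : ∀ (u : Fin n → A) (w : ℕ → A), w ∈ wordCylinder (List.ofFn u) ↔
      (fun i : Fin n => w i) = u := by
    intro u w
    constructor
    · intro hw
      funext i
      simpa using hw i (by simp)
    · rintro rfl i hi
      simp
  -- Since `S` depends on `n` letters only, the cylinders of length `n` inside it partition it.
  let F : Set (Fin n → A) := {u | wordCylinder (List.ofFn u) ⊆ S}
  have hSF : S = ⋃ u ∈ F, wordCylinder (List.ofFn u) := by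
    ext w
    simp only [Set.mem_iUnion]
    constructor
    · intro hw
      refine ⟨fun i => w i, fun v hv => ?_, (hmem _ _).mpr rfl⟩
      exact (hn fun i hi => (congrFun ((hmem _ _).mp hv) ⟨i, hi⟩).symm).mp hw
    · rintro ⟨u, hu, hw⟩
      exact hu hw
  have hF : F.Countable := Set.to_countable F
  have hdisj : F.PairwiseDisjoint fun u => wordCylinder (List.ofFn u) := by
    intro u _ v _ huv
    refine Set.disjoint_left.mpr fun w hu hv => huv ?_
    rw [← (hmem _ _).mp hu, ← (hmem _ _).mp hv]
  have hμS : μ S = ∑' u : F, μ (wordCylinder (List.ofFn u.1)) := by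
    conv_lhs => rw [hSF]
    exact measure_biUnion hF hdisj fun u _ => measurableSet_wordCylinder _
  calc μ (L ∩ S) = μ (⋃ u ∈ F, L ∩ wordCylinder (List.ofFn u)) := by
        conv_lhs => rw [hSF]
        rw [Set.inter_iUnion₂]
    _ ≤ ∑' u : F, μ (L ∩ wordCylinder (List.ofFn u.1)) := measure_biUnion_le μ hF _
    _ ≤ ∑' u : F, c * μ (wordCylinder (List.ofFn u.1)) := ENNReal.tsum_le_tsum fun u => h _
    _ = c * μ S := by rw [ENNReal.tsum_mul_left, hμS]

/-- A measurable set whose relative measure in all cylinders is bounded by a constant less than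
one is a null set. -/
theorem measure_eq_zero_of_wordCylinder {A : Type*} [Finite A] [Nonempty A] [MeasurableSpace A]
    [MeasurableSingletonClass A] (μ : Measure (ℕ → A)) [IsFiniteMeasure μ] {L : Set (ℕ → A)}
    (hL : MeasurableSet L) {c : ENNReal} (hc : c < 1)
    (h : ∀ x : List A, μ (L ∩ wordCylinder x) ≤ c * μ (wordCylinder x)) : μ L = 0 := by
  have happrox : ∀ ε : ENNReal, 0 < ε → μ L ≤ c * μ L + 2 * ε := by
    intro ε hε
    obtain ⟨S, hS, hSL⟩ := exists_measure_symmDiff_lt_of_generateFrom_isSetRing (μ := μ)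
      (isSetRing_prefixSets A)
      ⟨{Set.univ}, Set.countable_singleton _, by
        rintro _ rfl
        exact ⟨0, fun _ _ _ => rfl⟩, by simp⟩
      (measurableSpace_eq_generateFrom_prefixSets A) hL hε
    have h1 : μ (L \ S) ≤ ε := (measure_mono fun _ hw => Or.inr hw).trans hSL.le
    have h2 : μ (S \ L) ≤ ε := (measure_mono fun _ hw => Or.inl hw).trans hSL.le
    have h3 : μ S ≤ μ L + ε := calc
      μ S ≤ μ (L ∪ S \ L) := measure_mono <| by
        rw [Set.union_sdiff_self]
        exact Set.subset_union_right
      _ ≤ μ L + μ (S \ L) := measure_union_le _ _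
      _ ≤ μ L + ε := by gcongr
    calc μ L ≤ μ (L ∩ S) + μ (L \ S) := measure_le_inter_add_sdiff μ L S
      _ ≤ c * μ S + ε := add_le_add (measure_inter_le_of_wordCylinder μ h hS) h1
      _ ≤ c * (μ L + ε) + ε := by gcongr
      _ ≤ c * μ L + 2 * ε := by
        rw [mul_add, add_assoc, two_mul]
        gcongr
        exact mul_le_of_le_one_left zero_le hc.le
  have hle : μ L ≤ c * μ L := by
    refine ENNReal.le_of_forall_pos_le_add fun ε hε _ => ?_
    have := happrox (ε / 2) (by simpa using hε.ne')
    rwa [ENNReal.mul_div_cancel two_ne_zero ENNReal.ofNat_ne_top] at this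
  by_contra h0
  have : c * μ L < 1 * μ L := ENNReal.mul_lt_mul_left h0 (measure_ne_top μ L) hc
  rw [one_mul] at this
  exact this.not_ge hle

theorem mainTheorem9 {A : Type*} [Fintype A] [Nontrivial A] [MeasurableSpace A]
    [MeasurableSingletonClass A] (L : Set (ℕ → A)) (hL : IsOmegaRegular L)
    (hpos : 0 < uniformWordMeasure A L) :
    ∃ x : List A, MeasurableSet {w : ℕ → A | prependWord x w ∈ L} ∧
      uniformWordMeasure A {w : ℕ → A | prependWord x w ∈ L} = 1 := by
  obtain ⟨Q, _, M, rfl⟩ := hL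
  have hmeas : ∀ x : List A, MeasurableSet {w | prependWord x w ∈ M.buchiLanguage} := fun x =>
    measurable_prependWord x M.measurableSet_buchiLanguage
  have hquot : ∀ x : List A, {w | prependWord x w ∈ M.buchiLanguage} =
      (M.withStart (M.evalFrom M.start x)).buchiLanguage := fun x =>
    Set.ext fun w => M.prependWord_mem_buchiLanguage M.start x w
  by_contra! hne
  let values : Set ENNReal :=
    Set.range fun x : List A => uniformWordMeasure A {w | prependWord x w ∈ M.buchiLanguage}
  have hfin : values.Finite := by
    refine (Set.finite_range fun S : Set Q =>
      uniformWordMeasure A (M.withStart S).buchiLanguage).subset ?_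
    rintro _ ⟨x, rfl⟩
    exact ⟨_, congrArg _ (hquot x).symm⟩
  -- The maximum is attained at a quotient, hence is strictly below 1; a supremum of infinitely many
  -- values could equal 1.
  obtain ⟨_, ⟨y, rfl⟩, hmax⟩ := hfin.exists_maximal (Set.range_nonempty _)
  refine hpos.ne' (measure_eq_zero_of_wordCylinder _ M.measurableSet_buchiLanguage
    (lt_of_le_of_ne prob_le_one (hne y (hmeas y))) fun x => ?_)
  rw [uniformWordMeasure_inter_wordCylinder M.measurableSet_buchiLanguage, mul_comm]
  exact mul_le_mul_left ((le_total _ _).elim id fun h => hmax ⟨x, rfl⟩ h) _
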